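/- Let $0<a<1$, let $H$ be a separable complex Hilbert space and let $T\in L(H)$. Write $(1-t)^a=\sum_{n\ge0}\alpha_nt^n$ and $(1-t)^{-a}=\sum_{n\ge0}k_nt^n$ for $|t|<1$ (so $k_n>0$ for all $n$). The operator $T$ is called an $a$-contraction if the series $\sum_{n\ge0}\alpha_nT^{*n}T^n$ converges in the strong operator topology and its sum, denoted $(1-t)^a(T^*,T)$, is a non-negative operator. In that case let $D:=\big((1-t)^a(T^*,T)\big)^{1/2}$ and let $\mathfrak D:=\overline{DH}$ be the defect space. Let $\mathcal H_a$ be the Hilbert space of power series $f(t)=\sum_{n\ge0}f_nt^n$ with complex coefficients and norm $\|f\|^2=\sum_{n\ge0}|f_n|^2k_n<\infty$, and let $B_a$ be the (bounded) backward shift on $\mathcal H_a$, $B_af(t)=\frac{f(t)-f(0)}{t}$. A part of an operator is its restriction to a closed invariant subspace. The following statements are equivalent. (i) $T$ is an $a$-contraction. (ii) There exist a separable Hilbert space $\mathcal E$ and an isometry $S$ on some Hilbert space such that $T$ is unitarily equivalent to a part of $(B_a\otimes I_{\mathcal E})\oplus S$. Moreover, if (ii) holds, then one can take $\mathcal E=\mathfrak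 D$; that is, there is an isometry $S$ on some Hilbert space such that $T$ is unitarily equivalent to a part of $(B_a\otimes I_{\mathfrak D})\oplus S$. -/

import Mathlib

open Filter Topology
open scoped TensorProduct

universe u

/-! ### Taylor coefficients of `(1 - t) ^ (-s)` -/

/-- The Cesàro number `k^s(n) = s (s + 1) ⋯ (s + n - 1) / n!`, that is, the `n`-th Taylor
coefficient at the origin of `(1 - t) ^ (-s)`; see `hasSum_cesaroNumber`. -/
noncomputable def cesaroNumber (s : ℝ) (n : ℕ) : ℝ :=
  (∏ i ∈ Finset.range n, (s + i)) / (n.factorial : ℝ)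

theorem cesaroNumber_succ (s : ℝ) (n : ℕ) :
    ((n : ℝ) + 1) * cesaroNumber s (n + 1) = (s + n) * cesaroNumber s n := by
  have h1 : (n.factorial : ℝ) ≠ 0 := by exact_mod_cast n.factorial_ne_zero
  have h2 : (n : ℝ) + 1 ≠ 0 := by positivity
  simp only [cesaroNumber, Finset.prod_range_succ, Nat.factorial_succ, Nat.cast_mul,
    Nat.cast_add, Nat.cast_one]
  field_simp

theorem cesaroNumber_pos {s : ℝ} (hs : 0 < s) (n : ℕ) : 0 < cesaroNumber s n := by
  unfold cesaroNumber
  have : 0 < ∏ i ∈ Finset.range n, (s + i) := Finset.prod_pos fun i _ => by positivity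
  positivity

theorem cesaroNumber_eq_choose (s : ℝ) (n : ℕ) :
    cesaroNumber s n = Ring.choose (s + n - 1) n := by
  have h1 : (n.factorial : ℝ) ≠ 0 := by exact_mod_cast n.factorial_ne_zero
  rw [← Ring.multichoose_eq, cesaroNumber, div_eq_iff h1]
  have h := Ring.factorial_nsmul_multichoose_eq_ascPochhammer s n
  rw [nsmul_eq_mul, Polynomial.ascPochhammer_smeval_eq_eval] at h
  rw [mul_comm, h]
  clear h h1
  induction n with
  | zero => simp
  | succ n ih => rw [Finset.prod_range_succ, ih, ascPochhammer_succ_eval]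

theorem hasSum_cesaroNumber (s : ℝ) {t : ℝ} (ht : |t| < 1) :
    HasSum (fun n => cesaroNumber s n * t ^ n) ((1 - t) ^ (-s)) := by
  have h := (Real.one_div_one_sub_rpow_hasFPowerSeriesOnBall_zero s).hasSum (y := t) (by
    simpa [enorm_eq_nnnorm, ← NNReal.coe_lt_coe] using ht)
  have h0 : 0 ≤ 1 - t := by linarith [(abs_lt.mp ht).2]
  rw [Real.rpow_neg h0]
  simpa [cesaroNumber_eq_choose, mul_comm] using h

theorem cesaroNumber_le_mul_succ {s : ℝ} (hs : 0 < s) :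
    ∃ C : ℝ, ∀ n, cesaroNumber s n ≤ C * cesaroNumber s (n + 1) := by
  refine ⟨1 / s + 1, fun n => ?_⟩
  have h := cesaroNumber_succ s n
  have hp := cesaroNumber_pos hs n
  have hp' := cesaroNumber_pos hs (n + 1)
  have hsn : (0 : ℝ) < s + n := by positivity
  have : cesaroNumber s n = ((n : ℝ) + 1) / (s + n) * cesaroNumber s (n + 1) := by
    field_simp
    linarith
  rw [this]
  refine mul_le_mul_of_nonneg_right ?_ hp'.le
  rw [div_le_iff₀ hsn]
  have h2 : (1 / s + 1) * (s + n) = 1 + s + n + n / s := by field_simp; ring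
  have : (0 : ℝ) ≤ n / s := by positivity
  linarith

/-! ### The weighted space `𝓗_k` and its backward shift -/

/-- The power series `f` with `∑ |f_n|² k_n < ∞`. -/
noncomputable def weightedSubmodule (k : ℕ → ℝ) (hk : ∀ n, 0 < k n) :
    Submodule ℂ (PowerSeries ℂ) where
  carrier := {f | Summable fun n => ‖PowerSeries.coeff n f‖ ^ 2 * k n}
  zero_mem' := by simp
  add_mem' := by
    intro f g hf hg
    refine Summable.of_nonneg_of_le (fun n => by have := hk n; positivity) (fun n => ?_)
      ((hf.add hg).mul_left 2)
    have h1 : ‖PowerSeries.coeff n f + PowerSeries.coeff n g‖ ^ 2 ≤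
        2 * (‖PowerSeries.coeff n f‖ ^ 2 + ‖PowerSeries.coeff n g‖ ^ 2) := by
      have := norm_add_le (PowerSeries.coeff n f) (PowerSeries.coeff n g)
      nlinarith [norm_nonneg (PowerSeries.coeff n f + PowerSeries.coeff n g),
        sq_nonneg (‖PowerSeries.coeff n f‖ - ‖PowerSeries.coeff n g‖)]
    have := mul_le_mul_of_nonneg_right h1 (hk n).le
    simp only [map_add]
    linarith
  smul_mem' := by
    intro c f hf
    refine (hf.mul_left (‖c‖ ^ 2)).congr fun n => ?_
    simp [mul_pow, mul_assoc]

/-- The weighted Hilbert space `𝓗_k` of power series `f(t) = ∑ f_n t^n` with norm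
`‖f‖² = ∑ |f_n|² k_n`, where `k_n > 0`. -/
def WeightedSpace (k : ℕ → ℝ) (hk : ∀ n, 0 < k n) : Type :=
  weightedSubmodule k hk

namespace WeightedSpace

variable {k : ℕ → ℝ} {hk : ∀ n, 0 < k n}

noncomputable instance : AddCommGroup (WeightedSpace k hk) :=
  inferInstanceAs (AddCommGroup (weightedSubmodule k hk))

noncomputable instance : Module ℂ (WeightedSpace k hk) :=
  inferInstanceAs (Module ℂ (weightedSubmodule k hk))

/-- The Taylor coefficient `f_n`. -/
noncomputable def coeff (n : ℕ) : WeightedSpace k hk →ₗ[ℂ] ℂ :=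
  (PowerSeries.coeff n).comp (weightedSubmodule k hk).subtype

theorem summable (f : WeightedSpace k hk) : Summable fun n => ‖coeff n f‖ ^ 2 * k n :=
  f.2

theorem ext {f g : WeightedSpace k hk} (h : ∀ n, coeff n f = coeff n g) : f = g :=
  Subtype.ext (PowerSeries.ext h)

/-- The element of `𝓗_k` with given coefficients. -/
noncomputable def ofCoeff (u : ℕ → ℂ) (hu : Summable fun n => ‖u n‖ ^ 2 * k n) :
    WeightedSpace k hk :=
  ⟨PowerSeries.mk u, by simpa [weightedSubmodule] using hu⟩

@[simp]
theorem coeff_ofCoeff (u : ℕ → ℂ) (hu : Summable fun n => ‖u n‖ ^ 2 * k n) (n : ℕ) :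
    coeff n (ofCoeff (hk := hk) u hu) = u n := by
  exact PowerSeries.coeff_mk n u

theorem norm_sqrt_mul_sq (hk : ∀ n, 0 < k n) (n : ℕ) (z : ℂ) :
    ‖((Real.sqrt (k n) : ℝ) : ℂ) * z‖ ^ 2 = ‖z‖ ^ 2 * k n := by
  rw [norm_mul, mul_pow, Complex.norm_real, Real.norm_eq_abs, sq_abs, Real.sq_sqrt (hk n).le,
    mul_comm]

theorem memℓp_two_iff (u : ℕ → ℂ) :
    Memℓp u 2 ↔ Summable fun n => ‖u n‖ ^ 2 := by
  rw [memℓp_gen_iff (by norm_num)]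
  simp

/-- The identification `f ↦ (√k_n f_n)` of `𝓗_k` with `ℓ²`, which transports the Hilbert space
structure to `𝓗_k`. -/
noncomputable def toEll2 : WeightedSpace k hk ≃ₗ[ℂ] lp (fun _ : ℕ => ℂ) 2 where
  toFun f := ⟨fun n => ((Real.sqrt (k n) : ℝ) : ℂ) * coeff n f, by
    refine (memℓp_two_iff _).2 ?_
    simpa only [norm_sqrt_mul_sq hk] using f.summable⟩
  map_add' f g := by
    ext n
    exact (by simp [mul_add] : ((Real.sqrt (k n) : ℝ) : ℂ) * coeff n (f + g) =
      ((Real.sqrt (k n) : ℝ) : ℂ) * coeff n f + ((Real.sqrt (k n) : ℝ) : ℂ) * coeff n g)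
  map_smul' c f := by
    ext n
    simp [mul_left_comm]
  invFun u := ofCoeff (fun n => ((Real.sqrt (k n) : ℝ) : ℂ)⁻¹ * u n) (by
    refine ((memℓp_two_iff _).1 (lp.memℓp u)).congr fun n => ?_
    have h : ((Real.sqrt (k n) : ℝ) : ℂ) ≠ 0 := by
      exact_mod_cast (Real.sqrt_pos.2 (hk n)).ne'
    rw [← norm_sqrt_mul_sq hk, mul_inv_cancel_left₀ h])
  left_inv f := by
    refine ext fun n => ?_
    have h : ((Real.sqrt (k n) : ℝ) : ℂ) ≠ 0 := by
      exact_mod_cast (Real.sqrt_pos.2 (hk n)).ne'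
    simp [h]
  right_inv u := by
    ext n
    have h : ((Real.sqrt (k n) : ℝ) : ℂ) ≠ 0 := by
      exact_mod_cast (Real.sqrt_pos.2 (hk n)).ne'
    simp [h]

noncomputable instance : NormedAddCommGroup (WeightedSpace k hk) :=
  NormedAddCommGroup.induced _ _ (toEll2 (k := k) (hk := hk)).toLinearMap.toAddMonoidHom
    toEll2.injective

theorem norm_toEll2 (f : WeightedSpace k hk) : ‖toEll2 f‖ = ‖f‖ := rfl

noncomputable instance : InnerProductSpace ℂ (WeightedSpace k hk) where
  norm_smul_le c f := by
    rw [← norm_toEll2, ← norm_toEll2, map_smul]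
    exact norm_smul_le _ _
  inner f g := inner ℂ (toEll2 f) (toEll2 g)
  norm_sq_eq_re_inner f := norm_sq_eq_re_inner (𝕜 := ℂ) (toEll2 f)
  conj_inner_symm f g := inner_conj_symm (toEll2 f) (toEll2 g)
  add_left f g h := by simp
  smul_left f g c := by simp [mul_comm]

theorem norm_sq_eq (f : WeightedSpace k hk) : ‖f‖ ^ 2 = ∑' n, ‖coeff n f‖ ^ 2 * k n := by
  have h := lp.norm_rpow_eq_tsum (p := 2) (by norm_num) (toEll2 f)
  simp only [ENNReal.toReal_ofNat, Real.rpow_ofNat] at h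
  rw [← norm_toEll2, h]
  exact tsum_congr fun n => norm_sqrt_mul_sq hk n _

instance : CompleteSpace (WeightedSpace k hk) := by
  let e : WeightedSpace k hk ≃ₗᵢ[ℂ] lp (fun _ : ℕ => ℂ) 2 := ⟨toEll2, norm_toEll2⟩
  exact e.toIsometryEquiv.completeSpace

/-- The backward shift `(B_k f)(t) = (f(t) - f(0)) / t` on `𝓗_k`, which is bounded when
`k_n / k_{n+1}` is bounded. -/
noncomputable def backwardShift (hb : ∃ C : ℝ, ∀ n, k n ≤ C * k (n + 1)) :
    WeightedSpace k hk →L[ℂ] WeightedSpace k hk :=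
  have hC : ∀ (f : WeightedSpace k hk) (n : ℕ), ‖coeff (n + 1) f‖ ^ 2 * k n ≤
      hb.choose * (‖coeff (n + 1) f‖ ^ 2 * k (n + 1)) := fun f n => by
    have := mul_le_mul_of_nonneg_left (hb.choose_spec n) (sq_nonneg ‖coeff (n + 1) f‖)
    linarith
  have hs : ∀ f : WeightedSpace k hk, Summable fun n => ‖coeff (n + 1) f‖ ^ 2 * k n := fun f =>
    Summable.of_nonneg_of_le (fun n => by have := hk n; positivity) (hC f)
      (((summable_nat_add_iff 1).2 f.summable).mul_left hb.choose)
  LinearMap.mkContinuousOfExistsBound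
    { toFun := fun f => ofCoeff (fun n => coeff (n + 1) f) (hs f)
      map_add' := fun f g => ext fun n => by simp
      map_smul' := fun c f => ext fun n => by simp }
    (by
      have h0 : 0 ≤ hb.choose := by
        by_contra h
        have h1 := hb.choose_spec 0
        have h2 := hk 0
        have h3 := hk (0 + 1)
        nlinarith
      refine ⟨Real.sqrt hb.choose, fun f => ?_⟩
      refine le_of_sq_le_sq ?_ (by positivity)
      rw [mul_pow, Real.sq_sqrt h0, norm_sq_eq, norm_sq_eq]
      simp only [LinearMap.coe_mk, AddHom.coe_mk, coeff_ofCoeff]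
      have hs1 := (summable_nat_add_iff 1).2 f.summable
      calc ∑' n, ‖coeff (n + 1) f‖ ^ 2 * k n
          ≤ ∑' n, hb.choose * (‖coeff (n + 1) f‖ ^ 2 * k (n + 1)) :=
            (hs f).tsum_le_tsum (hC f) (hs1.mul_left _)
        _ = hb.choose * ∑' n, ‖coeff (n + 1) f‖ ^ 2 * k (n + 1) := tsum_mul_left
        _ ≤ hb.choose * ∑' n, ‖coeff n f‖ ^ 2 * k n := by
            refine mul_le_mul_of_nonneg_left ?_ h0
            rw [f.summable.tsum_eq_zero_add]
            have := hk 0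
            have : 0 ≤ ‖coeff 0 f‖ ^ 2 * k 0 := by positivity
            linarith)

@[simp]
theorem coeff_backwardShift (hb : ∃ C : ℝ, ∀ n, k n ≤ C * k (n + 1)) (f : WeightedSpace k hk)
    (n : ℕ) : coeff n (backwardShift hb f) = coeff (n + 1) f := by
  simp [backwardShift]

end WeightedSpace

/-- The space `𝓗_a`, i.e. `𝓗_k` for `k(t) = (1 - t) ^ (-a)`. -/
abbrev PowerSeriesSpace (a : ℝ) (ha : 0 < a) : Type :=
  WeightedSpace (cesaroNumber a) (cesaroNumber_pos ha)

/-- The backward shift `B_a` on `𝓗_a`. -/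
noncomputable def backwardShift (a : ℝ) (ha : 0 < a) : PowerSeriesSpace a ha →L[ℂ] PowerSeriesSpace a ha :=
  WeightedSpace.backwardShift (cesaroNumber_le_mul_succ ha)

/-! ### Hilbert space tensor products, direct sums, parts of operators -/

/-- The Hilbert space tensor product: the completion of the algebraic tensor product for the
inner product `⟪x ⊗ y, x' ⊗ y'⟫ = ⟪x, x'⟫ ⟪y, y'⟫`. -/
abbrev HilbertTensor (X E : Type*) [NormedAddCommGroup X] [InnerProductSpace ℂ X]
    [NormedAddCommGroup E] [InnerProductSpace ℂ E] : Type _ :=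
  UniformSpace.Completion (X ⊗[ℂ] E)

/-- The operator `A ⊗ I_E` on the Hilbert space tensor product. -/
noncomputable def tensorId {X : Type*} [NormedAddCommGroup X] [InnerProductSpace ℂ X]
    (A : X →L[ℂ] X) (E : Type*) [NormedAddCommGroup E] [InnerProductSpace ℂ E] :
    HilbertTensor X E →L[ℂ] HilbertTensor X E :=
  (A.rTensor E).completion

/-- The orthogonal direct sum `A ⊕ S` on the Hilbert space `X ⊕ Y`. -/
noncomputable def directSum {X Y : Type*} [NormedAddCommGroup X] [InnerProductSpace ℂ X]
    [NormedAddCommGroup Y] [InnerProductSpace ℂ Y] (A : X →L[ℂ] X) (S : Y →L[ℂ] Y) :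
    WithLp 2 (X × Y) →L[ℂ] WithLp 2 (X × Y) :=
  (WithLp.prodContinuousLinearEquiv 2 ℂ X Y).symm.toContinuousLinearMap ∘L
    (A.prodMap S) ∘L (WithLp.prodContinuousLinearEquiv 2 ℂ X Y).toContinuousLinearMap

/-- `T` is unitarily equivalent to a part of `A`, i.e. to the restriction of `A` to a closed
invariant subspace `M`. -/
def IsUnitarilyEquivalentToPart {H X : Type*} [NormedAddCommGroup H] [InnerProductSpace ℂ H]
    [NormedAddCommGroup X] [InnerProductSpace ℂ X] (T : H →L[ℂ] H) (A : X →L[ℂ] X) : Prop :=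
  ∃ (M : Submodule ℂ X) (hM : ∀ x ∈ M, A.toLinearMap x ∈ M) (U : H ≃ₗᵢ[ℂ] M),
    IsClosed (M : Set X) ∧ ∀ h : H, U (T h) = A.toLinearMap.restrict hM (U h)

/-! ### `a`-contractions, the defect operator and the defect space -/

section Hereditary

variable {H : Type*} [NormedAddCommGroup H] [InnerProductSpace ℂ H] [CompleteSpace H]

/-- The series `∑ α_n T*ⁿ Tⁿ` converges to `A` in the strong operator topology. -/
def HasHereditarySum (α : ℕ → ℝ) (T A : H →L[ℂ] H) : Prop :=
  ∀ x : H, Tendsto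
    (fun N => (∑ n ∈ Finset.range N,
      (α n : ℂ) • ((ContinuousLinearMap.adjoint T) ^ n * T ^ n)) x) atTop (𝓝 (A x))

open Classical in
/-- The operator `α(T*, T) = ∑ α_n T*ⁿ Tⁿ` (strong operator topology); `0` by convention if the
series does not converge. -/
noncomputable def hereditary (α : ℕ → ℝ) (T : H →L[ℂ] H) : H →L[ℂ] H :=
  if h : ∃ A, HasHereditarySum α T A then h.choose else 0

/-- `T` is an `a`-contraction: with `α(t) = (1 - t) ^ a`, the series `α(T*, T)` converges in the
strong operator topology and its sum is a non-negative operator. -/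
def IsAContraction (a : ℝ) (T : H →L[ℂ] H) : Prop :=
  ∃ A : H →L[ℂ] H, HasHereditarySum (cesaroNumber (-a)) T A ∧ A.IsPositive

/-- The defect operator `D = ((1 - t) ^ a (T*, T)) ^ (1/2)`. -/
noncomputable def defectOperator (a : ℝ) (T : H →L[ℂ] H) : H →L[ℂ] H :=
  CFC.sqrt (hereditary (cesaroNumber (-a)) T)

/-- The defect space, the closure of the range of the defect operator. -/
noncomputable abbrev defectSpace (a : ℝ) (T : H →L[ℂ] H) : Submodule ℂ H :=
  (defectOperator a T).range.topologicalClosure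

end Hereditary

/-- For some isometry `S` on some Hilbert space, `T` is unitarily equivalent to a part of
`(B_a ⊗ I_E) ⊕ S`. -/
def HasModel {H : Type u} [NormedAddCommGroup H] [InnerProductSpace ℂ H]
    (a : ℝ) (ha : 0 < a) (T : H →L[ℂ] H)
    (E : Type u) [NormedAddCommGroup E] [InnerProductSpace ℂ E] : Prop :=
  ∃ (K : Type u) (_ : NormedAddCommGroup K) (_ : InnerProductSpace ℂ K) (_ : CompleteSpace K)
    (S : K →ₗᵢ[ℂ] K),
    IsUnitarilyEquivalentToPart T
      (directSum (tensorId (backwardShift a ha) E) S.toContinuousLinearMap)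

/-!
Write `α(t) = (1 - t) ^ a` and `k(t) = (1 - t) ^ (-a)`, so that `α(t) k(t) = 1`. On `𝓗_a ⊗ E` the
operator `B = B_a ⊗ I` shifts coefficients, so `∑_{n < N} α_n ‖Bⁿ y‖²` is a combination of the
`‖y_j‖²` whose weights are the coefficients of `(∑_{n < N} α_n tⁿ) k(t)`. They are nonnegative:
since `α_n ≤ 0` for `n ≥ 1`, truncating `α` can only increase a coefficient of `α(t) k(t) = 1`.
For an isometry the same sums are `‖z‖² ∑_{n < N} α_n ≥ 0`. Hence the partial sums of the
hereditary series of a part of `B ⊕ S` are positive and eventually decreasing, so they converge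
strongly to a positive operator.

Conversely, let `V x = (D Tⁿ x)_n`, which intertwines `T` with `B` by construction. Inverting
`‖D Tᵐ x‖² = ∑ α_n ‖Tⁿ⁺ᵐ x‖²` by means of `k` leaves a remainder after `M` steps, of the form
`∑ i, w_{M,i} ‖Tᴹ⁺ⁱ x‖²` with `w_{M,i} ≥ 0`; so `V` is a contraction into `𝓗_a ⊗ 𝔇`. The weights
satisfy `w_{M+1,i} / w_{M,i} → 1` uniformly in `i`, so the remainder of `x` after `M + 1` steps and
that of `T x` after `M` steps have the same limit. This says that `T` preserves the defect
`‖x‖² - ‖V x‖²` of `V`, so it induces an isometry `S` on the closure of the range of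
`(1 - V*V)^(1/2)`.
-/

/-! ### Recurrences and reciprocity for Cesàro numbers -/

@[simp]
theorem cesaroNumber_zero_right (s : ℝ) : cesaroNumber s 0 = 1 := by simp [cesaroNumber]

theorem cesaroNumber_nonneg {s : ℝ} (hs : 0 ≤ s) (n : ℕ) : 0 ≤ cesaroNumber s n := by
  unfold cesaroNumber
  have : 0 ≤ ∏ i ∈ Finset.range n, (s + i) := Finset.prod_nonneg fun i _ => by positivity
  positivity

theorem cesaroNumber_eq_multichoose (s : ℝ) (n : ℕ) :
    cesaroNumber s n = Ring.multichoose s n := by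
  rw [cesaroNumber_eq_choose, Ring.multichoose_eq]

theorem cesaroNumber_add_one_succ (s : ℝ) (n : ℕ) :
    cesaroNumber (s + 1) (n + 1) = cesaroNumber s (n + 1) + cesaroNumber (s + 1) n := by
  simp only [cesaroNumber_eq_multichoose, Ring.multichoose_succ_succ]

theorem succ_mul_cesaroNumber_succ (s : ℝ) (n : ℕ) :
    ((n : ℝ) + 1) * cesaroNumber s (n + 1) = s * cesaroNumber (s + 1) n := by
  linear_combination cesaroNumber_succ (s + 1) n -
    ((n : ℝ) + 1) * cesaroNumber_add_one_succ s n

theorem sum_range_succ_cesaroNumber (s : ℝ) (n : ℕ) :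
    ∑ i ∈ Finset.range (n + 1), cesaroNumber s i = cesaroNumber (s + 1) n := by
  induction n with
  | zero => simp
  | succ n ih => rw [Finset.sum_range_succ, ih, cesaroNumber_add_one_succ, add_comm]

theorem cesaroNumber_neg_succ_nonpos {a : ℝ} (ha₀ : 0 ≤ a) (ha₁ : a ≤ 1) (n : ℕ) :
    cesaroNumber (-a) (n + 1) ≤ 0 := by
  have h := succ_mul_cesaroNumber_succ (-a) n
  have hnonneg := mul_nonneg ha₀ (cesaroNumber_nonneg (s := -a + 1) (by linarith) n)
  exact nonpos_of_mul_nonpos_right (by linarith) (by positivity : (0 : ℝ) < n + 1)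

theorem sum_range_cesaroNumber_neg_nonneg {a : ℝ} (ha₁ : a ≤ 1) (N : ℕ) :
    0 ≤ ∑ n ∈ Finset.range N, cesaroNumber (-a) n := by
  cases N with
  | zero => simp
  | succ N =>
    rw [sum_range_succ_cesaroNumber]
    exact cesaroNumber_nonneg (by linarith) N

theorem mk_cesaroNumber_eq_rescale_binomialSeries (s : ℝ) :
    PowerSeries.mk (cesaroNumber s) =
      PowerSeries.rescale (-1) (PowerSeries.binomialSeries ℝ (-s)) := by
  ext n
  rw [PowerSeries.coeff_mk, PowerSeries.coeff_rescale, PowerSeries.binomialSeries_coeff,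
    Ring.choose_neg', cesaroNumber_eq_multichoose]
  simp [Int.negOnePow_def, Units.smul_def, ← mul_assoc, ← mul_pow]

theorem mk_cesaroNumber_neg_mul_mk_cesaroNumber (s : ℝ) :
    PowerSeries.mk (cesaroNumber (-s)) * PowerSeries.mk (cesaroNumber s) = 1 := by
  rw [mk_cesaroNumber_eq_rescale_binomialSeries, mk_cesaroNumber_eq_rescale_binomialSeries,
    ← map_mul, ← PowerSeries.binomialSeries_add, neg_neg, add_neg_cancel,
    PowerSeries.binomialSeries_zero, map_one]

/-! ### Remainders of the inversion of `(1 - t) ^ a` -/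

/-- The coefficient of `t ^ i` in `α(t) * ∑ m, k (M + m) * t ^ m`. When `α(t) * k(t) = 1`, these
are the coefficients of the remainder in
`1 - α(t) * ∑ m < M, k m * t ^ m = t ^ M * ∑ i, remainderWeight α k M i * t ^ i`. -/
def remainderWeight (α k : ℕ → ℝ) (M i : ℕ) : ℝ :=
  ∑ p ∈ Finset.HasAntidiagonal.antidiagonal i, α p.1 * k (M + p.2)

theorem remainderWeight_zero_right (α k : ℕ → ℝ) (M : ℕ) :
    remainderWeight α k M 0 = α 0 * k M := by
  simp [remainderWeight]

theorem remainderWeight_succ_right (α k : ℕ → ℝ) (M i : ℕ) :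
    remainderWeight α k M (i + 1) = α (i + 1) * k M + remainderWeight α k (M + 1) i := by
  simp only [remainderWeight, Finset.Nat.sum_antidiagonal_succ', add_zero, add_assoc,
    add_comm 1]

section Reciprocal

variable {α k : ℕ → ℝ}

theorem remainderWeight_zero_left (hαk : PowerSeries.mk α * PowerSeries.mk k = 1) (i : ℕ) :
    remainderWeight α k 0 i = if i = 0 then 1 else 0 := by
  simpa [remainderWeight, PowerSeries.coeff_mul, PowerSeries.coeff_one] using
    congrArg (PowerSeries.coeff i) hαk

theorem hasSum_remainderWeight (hαk : PowerSeries.mk α * PowerSeries.mk k = 1) {u d : ℕ → ℝ}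
    (hd : ∀ m, HasSum (fun n => α n * u (n + m)) (d m)) (M : ℕ) :
    HasSum (fun i => remainderWeight α k M i * u (M + i))
      (u 0 - ∑ m ∈ Finset.range M, k m * d m) := by
  induction M with
  | zero =>
    convert hasSum_single 0 fun i hi => ?_ using 1
    · simp [remainderWeight_zero_left hαk]
    · simp [remainderWeight_zero_left hαk, hi]
  | succ M ih =>
    have hdiff := (hasSum_nat_add_iff' 1).2 (ih.sub ((hd M).mul_left (k M)))
    have hzero : remainderWeight α k M 0 * u (M + 0) - k M * (α 0 * u (0 + M)) = 0 := by
      rw [remainderWeight_zero_right, add_zero, zero_add]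
      ring
    have hsucc (i) : remainderWeight α k M (i + 1) * u (M + (i + 1)) -
        k M * (α (i + 1) * u (i + 1 + M)) = remainderWeight α k (M + 1) i * u (M + 1 + i) := by
      rw [remainderWeight_succ_right, add_comm (i + 1) M, add_right_comm M 1 i, ← add_assoc]
      ring
    rw [Finset.sum_range_one, hzero, sub_zero, sub_sub, ← Finset.sum_range_succ] at hdiff
    simpa only [hsucc] using hdiff

end Reciprocal

section CesaroRemainder

variable {a : ℝ}

theorem add_mul_remainderWeight_cesaroNumber (a : ℝ) (M i : ℕ) :
    ((M : ℝ) + i) * remainderWeight (cesaroNumber (-a)) (cesaroNumber a) M i =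
      M * cesaroNumber a M * cesaroNumber (-a + 1) i := by
  induction i generalizing M with
  | zero => simp [remainderWeight_zero_right]
  | succ i ih =>
    rw [remainderWeight_succ_right, cesaroNumber_add_one_succ]
    have h := ih (M + 1)
    push_cast at h ⊢
    linear_combination h + cesaroNumber (-a + 1) i * cesaroNumber_succ a M +
      cesaroNumber a M * succ_mul_cesaroNumber_succ (-a) i

theorem remainderWeight_cesaroNumber_nonneg (ha₀ : 0 ≤ a) (ha₁ : a ≤ 1) (M i : ℕ) :
    0 ≤ remainderWeight (cesaroNumber (-a)) (cesaroNumber a) M i := by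
  rcases M.eq_zero_or_pos with rfl | hM
  · rw [remainderWeight_zero_left (mk_cesaroNumber_neg_mul_mk_cesaroNumber a)]
    positivity
  · have hpos : (0 : ℝ) < M + i := by positivity
    refine nonneg_of_mul_nonneg_right ?_ hpos
    rw [add_mul_remainderWeight_cesaroNumber]
    have := cesaroNumber_nonneg ha₀ M
    have := cesaroNumber_nonneg (s := -a + 1) (by linarith) i
    positivity

theorem remainderWeight_cesaroNumber_succ_left (a : ℝ) (M i : ℕ) :
    M * ((M + 1 + i) * remainderWeight (cesaroNumber (-a)) (cesaroNumber a) (M + 1) i) =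
      (M + a) * ((M + i) * remainderWeight (cesaroNumber (-a)) (cesaroNumber a) M i) := by
  have h := add_mul_remainderWeight_cesaroNumber a (M + 1) i
  rw [add_mul_remainderWeight_cesaroNumber]
  push_cast at h
  linear_combination M * h + M * cesaroNumber (-a + 1) i * cesaroNumber_succ a M

theorem add_mul_remainderWeight_le (ha₀ : 0 ≤ a) (ha₁ : a ≤ 1) {M : ℕ} (hM : 0 < M) (i : ℕ) :
    (M + a) * remainderWeight (cesaroNumber (-a)) (cesaroNumber a) M i ≤
      (M + 1) * remainderWeight (cesaroNumber (-a)) (cesaroNumber a) (M + 1) i := by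
  have hrec := remainderWeight_cesaroNumber_succ_left a M i
  have hnonneg := mul_nonneg (Nat.cast_nonneg (α := ℝ) i)
    (remainderWeight_cesaroNumber_nonneg ha₀ ha₁ (M + 1) i)
  have hpos : (0 : ℝ) < M + i := by positivity
  refine le_of_mul_le_mul_left ?_ hpos
  linarith

theorem mul_remainderWeight_succ_le (ha₀ : 0 ≤ a) (ha₁ : a ≤ 1) (M i : ℕ) :
    M * remainderWeight (cesaroNumber (-a)) (cesaroNumber a) (M + 1) i ≤
      (M + a) * remainderWeight (cesaroNumber (-a)) (cesaroNumber a) M i := by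
  have hrec := remainderWeight_cesaroNumber_succ_left a M i
  have hnonneg := mul_nonneg (by positivity : 0 ≤ (M : ℝ) + a)
    (remainderWeight_cesaroNumber_nonneg ha₀ ha₁ M i)
  have hpos : (0 : ℝ) < M + 1 + i := by positivity
  refine le_of_mul_le_mul_left ?_ hpos
  linarith

theorem tendsto_natCast_add_div_natCast_add (b c : ℝ) :
    Tendsto (fun n : ℕ => ((n : ℝ) + b) / (n + c)) atTop (𝓝 1) := by
  simpa [add_comm] using tendsto_add_mul_div_add_mul_atTop_nhds b c 1 one_ne_zero

variable {u d : ℕ → ℝ}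

theorem sum_range_cesaroNumber_mul_le (ha₀ : 0 ≤ a) (ha₁ : a ≤ 1) (hu : ∀ n, 0 ≤ u n)
    (hd : ∀ m, HasSum (fun n => cesaroNumber (-a) n * u (n + m)) (d m)) (M : ℕ) :
    ∑ m ∈ Finset.range M, cesaroNumber a m * d m ≤ u 0 :=
  sub_nonneg.1 <| (hasSum_remainderWeight (mk_cesaroNumber_neg_mul_mk_cesaroNumber a) hd M).nonneg
    fun i => mul_nonneg (remainderWeight_cesaroNumber_nonneg ha₀ ha₁ M i) (hu _)

theorem summable_cesaroNumber_mul (ha₀ : 0 ≤ a) (ha₁ : a ≤ 1) (hu : ∀ n, 0 ≤ u n)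
    (hd : ∀ m, HasSum (fun n => cesaroNumber (-a) n * u (n + m)) (d m)) (hd₀ : ∀ m, 0 ≤ d m) :
    Summable fun m => cesaroNumber a m * d m :=
  summable_of_sum_range_le (fun m => mul_nonneg (cesaroNumber_nonneg ha₀ m) (hd₀ m))
    (sum_range_cesaroNumber_mul_le ha₀ ha₁ hu hd)

theorem tsum_cesaroNumber_mul_le (ha₀ : 0 ≤ a) (ha₁ : a ≤ 1) (hu : ∀ n, 0 ≤ u n)
    (hd : ∀ m, HasSum (fun n => cesaroNumber (-a) n * u (n + m)) (d m)) (hd₀ : ∀ m, 0 ≤ d m) :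
    ∑' m, cesaroNumber a m * d m ≤ u 0 :=
  Real.tsum_le_of_sum_range_le (fun m => mul_nonneg (cesaroNumber_nonneg ha₀ m) (hd₀ m))
    (sum_range_cesaroNumber_mul_le ha₀ ha₁ hu hd)

theorem sub_tsum_cesaroNumber_mul_shift (ha₀ : 0 ≤ a) (ha₁ : a ≤ 1) (hu : ∀ n, 0 ≤ u n)
    (hd : ∀ m, HasSum (fun n => cesaroNumber (-a) n * u (n + m)) (d m)) (hd₀ : ∀ m, 0 ≤ d m) :
    u 1 - ∑' m, cesaroNumber a m * d (m + 1) = u 0 - ∑' m, cesaroNumber a m * d m := by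
  have hαk := mk_cesaroNumber_neg_mul_mk_cesaroNumber a
  have hd' (m) : HasSum (fun n => cesaroNumber (-a) n * u (n + m + 1)) (d (m + 1)) := hd (m + 1)
  set X := fun M => u 0 - ∑ m ∈ Finset.range (M + 1), cesaroNumber a m * d m
  set Y := fun M => u 1 - ∑ m ∈ Finset.range M, cesaroNumber a m * d (m + 1)
  have hX (M) : HasSum (fun i => remainderWeight (cesaroNumber (-a)) (cesaroNumber a) (M + 1) i *
      u (M + i + 1)) (X M) := by
    simpa only [add_right_comm] using hasSum_remainderWeight hαk hd (M + 1)
  have hY (M) : HasSum (fun i => remainderWeight (cesaroNumber (-a)) (cesaroNumber a) M i *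
      u (M + i + 1)) (Y M) :=
    hasSum_remainderWeight hαk (u := fun n => u (n + 1)) hd' M
  have hYX {M : ℕ} (hM : 0 < M) : (M + a) * Y M ≤ (M + 1) * X M :=
    hasSum_le (fun i => by
      simpa only [mul_assoc] using
        mul_le_mul_of_nonneg_right (add_mul_remainderWeight_le ha₀ ha₁ hM i) (hu _))
      ((hY M).mul_left _) ((hX M).mul_left _)
  have hXY (M : ℕ) : M * X M ≤ (M + a) * Y M :=
    hasSum_le (fun i => by
      simpa only [mul_assoc] using
        mul_le_mul_of_nonneg_right (mul_remainderWeight_succ_le ha₀ ha₁ M i) (hu _))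
      ((hX M).mul_left _) ((hY M).mul_left _)
  have hsum := summable_cesaroNumber_mul ha₀ ha₁ hu hd hd₀
  have hsum' := summable_cesaroNumber_mul ha₀ ha₁ (fun n => hu (n + 1)) hd' fun m => hd₀ (m + 1)
  have hX_lim := ((tendsto_add_atTop_iff_nat 1).2 hsum.hasSum.tendsto_sum_nat).const_sub (u 0)
  have hY_lim := hsum'.hasSum.tendsto_sum_nat.const_sub (u 1)
  refine le_antisymm (le_of_tendsto_of_tendsto hY_lim
    (by simpa using (tendsto_natCast_add_div_natCast_add 1 a).mul hX_lim) ?_)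
    (le_of_tendsto_of_tendsto hX_lim
      (by simpa using (tendsto_natCast_add_div_natCast_add a 0).mul hY_lim) ?_)
  all_goals
    filter_upwards [eventually_gt_atTop 0] with M hM
    rw [div_mul_eq_mul_div, le_div_iff₀' (by positivity)]
  · exact hYX hM
  · simpa using hXY M

end CesaroRemainder

/-! ### Monotone convergence of positive operators and hereditary sums -/

section HereditarySum

open ContinuousLinearMap
open scoped ComplexOrder

variable {H : Type*} [NormedAddCommGroup H] [InnerProductSpace ℂ H]

theorem isPositive_iff_forall_inner_nonneg (P : H →L[ℂ] H) :
    P.IsPositive ↔ ∀ x, 0 ≤ inner ℂ (P x) x := by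
  rw [isPositive_iff_complex]
  refine forall_congr' fun x => ?_
  rw [Complex.nonneg_iff, and_comm, Complex.ext_iff]
  simp

variable [CompleteSpace H]

theorem sqrt_apply_sqrt_apply {P : H →L[ℂ] H} (hP : P.IsPositive) (x : H) :
    CFC.sqrt P (CFC.sqrt P x) = P x := by
  rw [← mul_apply_eq_comp, CFC.sqrt_mul_sqrt_self P ((nonneg_iff_isPositive P).2 hP)]

theorem norm_sqrt_apply_sq {P : H →L[ℂ] H} (hP : P.IsPositive) (x : H) :
    ‖CFC.sqrt P x‖ ^ 2 = (inner ℂ (P x) x).re := by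
  have hsqrt := (nonneg_iff_isPositive _).1 (CFC.sqrt_nonneg P)
  rw [← sqrt_apply_sqrt_apply hP, hsqrt.inner_left_eq_inner_right]
  exact norm_sq_eq_re_inner (𝕜 := ℂ) _

theorem norm_apply_sq_le_norm_mul_re_inner {P : H →L[ℂ] H} (hP : P.IsPositive) (x : H) :
    ‖P x‖ ^ 2 ≤ ‖P‖ * (inner ℂ (P x) x).re := by
  have hbound (y : H) : ‖CFC.sqrt P y‖ ^ 2 ≤ ‖P‖ * ‖y‖ ^ 2 :=
    calc ‖CFC.sqrt P y‖ ^ 2 = (inner ℂ (P y) y).re := norm_sqrt_apply_sq hP y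
      _ ≤ ‖P y‖ * ‖y‖ := re_inner_le_norm (𝕜 := ℂ) _ _
      _ ≤ ‖P‖ * ‖y‖ ^ 2 := by
        rw [sq, ← mul_assoc]
        exact mul_le_mul_of_nonneg_right (P.le_opNorm y) (norm_nonneg y)
  simpa only [sqrt_apply_sqrt_apply hP, norm_sqrt_apply_sq hP] using hbound (CFC.sqrt P x)

theorem norm_sub_apply_sq_le_of_le {P Q : H →L[ℂ] H} (hP : 0 ≤ P) (hPQ : P ≤ Q) (x : H) :
    ‖Q x - P x‖ ^ 2 ≤ ‖Q‖ * ((inner ℂ (Q x) x).re - (inner ℂ (P x) x).re) := by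
  have hsub : 0 ≤ Q - P := sub_nonneg.2 hPQ
  have hnorm : ‖Q - P‖ ≤ ‖Q‖ :=
    CStarAlgebra.norm_le_norm_of_nonneg_of_le hsub (sub_le_self Q hP)
  have hpos := (nonneg_iff_isPositive _).1 hsub
  have h := (norm_apply_sq_le_norm_mul_re_inner hpos x).trans
    (mul_le_mul_of_nonneg_right hnorm (hpos.re_inner_nonneg_left x))
  simpa only [sub_apply, inner_sub_left, Complex.sub_re] using h

theorem cauchySeq_apply_of_antitone {G : ℕ → H →L[ℂ] H} (hG : Antitone G) (hG₀ : ∀ N, 0 ≤ G N)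
    (x : H) : CauchySeq fun N => G N x := by
  set f : ℕ → ℝ := fun N => (inner ℂ (G N x) x).re
  have hf_anti : Antitone f := fun M N hMN => by
    have h := IsPositive.re_inner_nonneg_left ((le_def _ _).1 (hG hMN)) x
    simpa [inner_sub_left] using h
  have hf_bdd : BddBelow (Set.range f) := ⟨0, by
    rintro _ ⟨N, rfl⟩
    exact IsPositive.re_inner_nonneg_left ((nonneg_iff_isPositive _).1 (hG₀ N)) x⟩
  have hf_lim := tendsto_atTop_ciInf hf_anti hf_bdd
  refine cauchySeq_of_le_tendsto_0' (fun N => √(‖G 0‖ * (f N - ⨅ i, f i))) (fun M N hMN => ?_) ?_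
  · rw [dist_eq_norm]
    refine Real.le_sqrt_of_sq_le ((norm_sub_apply_sq_le_of_le (hG₀ N) (hG hMN) x).trans ?_)
    exact mul_le_mul (CStarAlgebra.norm_le_norm_of_nonneg_of_le (hG₀ M) (hG M.zero_le))
      (sub_le_sub_left (ciInf_le hf_bdd N) _) (sub_nonneg.2 (hf_anti hMN)) (norm_nonneg _)
  · simpa using ((hf_lim.sub_const (⨅ i, f i)).const_mul ‖G 0‖).sqrt

theorem exists_isPositive_tendsto_of_antitone {G : ℕ → H →L[ℂ] H} (hG : Antitone G)
    (hG₀ : ∀ N, 0 ≤ G N) :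
    ∃ A : H →L[ℂ] H, A.IsPositive ∧ ∀ x, Tendsto (fun N => G N x) atTop (𝓝 (A x)) := by
  choose g hg using fun x => cauchySeq_tendsto_of_complete (cauchySeq_apply_of_antitone hG hG₀ x)
  refine ⟨continuousLinearMapOfTendsto G (tendsto_pi_nhds.2 hg), ?_, hg⟩
  refine (isPositive_iff_forall_inner_nonneg _).2 fun x => ?_
  exact ge_of_tendsto' ((hg x).inner tendsto_const_nhds) fun N =>
    ((nonneg_iff_isPositive _).1 (hG₀ N)).inner_nonneg_left x

/-- The partial sum `∑ n < N, α_n T*ⁿ Tⁿ` of the hereditary series, so that `HasHereditarySum` is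
its strong convergence. -/
noncomputable def hereditaryPartialSum (α : ℕ → ℝ) (T : H →L[ℂ] H) (N : ℕ) : H →L[ℂ] H :=
  ∑ n ∈ Finset.range N, (α n : ℂ) • ((adjoint T) ^ n * T ^ n)

theorem adjoint_pow_mul_pow (T : H →L[ℂ] H) (n : ℕ) :
    (adjoint T) ^ n * T ^ n = adjoint (T ^ n) ∘L T ^ n := by
  rw [← star_eq_adjoint, ← star_eq_adjoint, star_pow]
  rfl

theorem inner_hereditaryPartialSum_self (α : ℕ → ℝ) (T : H →L[ℂ] H) (N : ℕ) (x : H) :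
    inner ℂ (hereditaryPartialSum α T N x) x =
      ((∑ n ∈ Finset.range N, α n * ‖(T ^ n) x‖ ^ 2 : ℝ) : ℂ) := by
  simp only [hereditaryPartialSum, sum_apply, sum_inner, Complex.ofReal_sum]
  refine Finset.sum_congr rfl fun n _ => ?_
  rw [smul_apply, inner_smul_left, adjoint_pow_mul_pow, comp_apply, adjoint_inner_left,
    inner_self_eq_norm_sq_to_K, Complex.conj_ofReal]
  simp

theorem hereditaryPartialSum_nonneg {α : ℕ → ℝ} {T : H →L[ℂ] H} {N : ℕ}
    (hT : ∀ x, 0 ≤ ∑ n ∈ Finset.range N, α n * ‖(T ^ n) x‖ ^ 2) :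
    0 ≤ hereditaryPartialSum α T N := by
  rw [nonneg_iff_isPositive, isPositive_iff_forall_inner_nonneg]
  intro x
  rw [inner_hereditaryPartialSum_self]
  exact_mod_cast hT x

theorem antitone_hereditaryPartialSum_succ {α : ℕ → ℝ} (hα : ∀ n, α (n + 1) ≤ 0)
    (T : H →L[ℂ] H) : Antitone fun N => hereditaryPartialSum α T (N + 1) := by
  refine antitone_nat_of_succ_le fun N => ?_
  have hcoeff : (0 : ℂ) ≤ -(α (N + 1) : ℂ) := by exact_mod_cast neg_nonneg.2 (hα N)
  refine (ContinuousLinearMap.le_def _ _).2 ?_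
  rw [hereditaryPartialSum, hereditaryPartialSum, Finset.sum_range_succ _ (N + 1),
    sub_add_cancel_left, adjoint_pow_mul_pow, ← neg_smul]
  exact (isPositive_adjoint_comp_self (T ^ (N + 1))).smul_of_nonneg hcoeff

theorem HasHereditarySum.unique {α : ℕ → ℝ} {T A B : H →L[ℂ] H} (hA : HasHereditarySum α T A)
    (hB : HasHereditarySum α T B) : A = B :=
  ContinuousLinearMap.ext fun x => tendsto_nhds_unique (hA x) (hB x)

theorem HasHereditarySum.hereditary_eq {α : ℕ → ℝ} {T A : H →L[ℂ] H}
    (hA : HasHereditarySum α T A) : hereditary α T = A := by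
  have h : ∃ A, HasHereditarySum α T A := ⟨A, hA⟩
  rw [hereditary, dif_pos h]
  exact h.choose_spec.unique hA

theorem hasSum_of_tendsto_sum_range_of_nonpos {f : ℕ → ℝ} (hf : ∀ n, f (n + 1) ≤ 0) {r : ℝ}
    (h : Tendsto (fun N => ∑ n ∈ Finset.range N, f n) atTop (𝓝 r)) : HasSum f r := by
  have htail : HasSum (fun n => -f (n + 1)) (f 0 - r) := by
    rw [hasSum_iff_tendsto_nat_of_nonneg fun n => neg_nonneg.2 (hf n)]
    refine (((tendsto_add_atTop_iff_nat 1).2 h).const_sub (f 0)).congr fun N => ?_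
    rw [Finset.sum_range_succ', Finset.sum_neg_distrib]
    ring
  rw [← hasSum_nat_add_iff' 1]
  simpa using htail.neg

theorem HasHereditarySum.hasSum {α : ℕ → ℝ} (hα : ∀ n, α (n + 1) ≤ 0) {T A : H →L[ℂ] H}
    (hA : HasHereditarySum α T A) (x : H) :
    HasSum (fun n => α n * ‖(T ^ n) x‖ ^ 2) (inner ℂ (A x) x).re := by
  refine hasSum_of_tendsto_sum_range_of_nonpos
    (fun n => mul_nonpos_of_nonpos_of_nonneg (hα n) (by positivity)) ?_
  refine ((Complex.continuous_re.tendsto _).comp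
    ((hA x).inner tendsto_const_nhds)).congr fun N => ?_
  exact congrArg Complex.re (inner_hereditaryPartialSum_self α T N x)

theorem exists_isPositive_hasHereditarySum {α : ℕ → ℝ} (hα : ∀ n, α (n + 1) ≤ 0)
    {T : H →L[ℂ] H} (hT : ∀ N x, 0 ≤ ∑ n ∈ Finset.range N, α n * ‖(T ^ n) x‖ ^ 2) :
    ∃ A : H →L[ℂ] H, HasHereditarySum α T A ∧ A.IsPositive := by
  obtain ⟨A, hA, hlim⟩ := exists_isPositive_tendsto_of_antitone
    (antitone_hereditaryPartialSum_succ hα T) fun N => hereditaryPartialSum_nonneg (hT (N + 1))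
  exact ⟨A, fun x => (tendsto_add_atTop_iff_nat 1).1 (hlim x), hA⟩

end HereditarySum

/-! ### `𝓗_k ⊗ E` as a weighted space of `E`-valued sequences -/

namespace WeightedSpace

variable {k : ℕ → ℝ} {hk : ∀ n, 0 < k n}
variable {E : Type*} [NormedAddCommGroup E] [InnerProductSpace ℂ E]

theorem memℓp_two_smul (v : lp (fun _ : ℕ => ℂ) 2) (e : E) : Memℓp (fun n => v n • e) 2 := by
  rw [memℓp_gen_iff (by norm_num)]
  refine (((memℓp_two_iff _).1 (lp.memℓp v)).mul_right (‖e‖ ^ 2)).congr fun n => ?_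
  simp [norm_smul, mul_pow]

/-- The map `f ⊗ e ↦ (√k_n f_n e)_n` from the algebraic tensor product to `ℓ²(E)`; the factors
`√k_n` make it isometric for the unweighted norm of the target. -/
noncomputable def tensorToSeq : WeightedSpace k hk ⊗[ℂ] E →ₗ[ℂ] lp (fun _ : ℕ => E) 2 :=
  TensorProduct.lift <| LinearMap.mk₂ ℂ
    (fun f e => (⟨fun n => toEll2 f n • e, memℓp_two_smul (toEll2 f) e⟩ : lp (fun _ : ℕ => E) 2))
    (fun f g e => by ext n; rw [lp.coeFn_add]; simp [add_smul])
    (fun c f e => by ext n; simp [mul_smul])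
    (fun f e e' => by ext n; rw [lp.coeFn_add]; simp)
    (fun c f e => by ext n; simp [smul_comm c])

theorem tensorToSeq_tmul (f : WeightedSpace k hk) (e : E) (n : ℕ) :
    tensorToSeq (f ⊗ₜ[ℂ] e) n = toEll2 f n • e := rfl

theorem inner_tensorToSeq (x y : WeightedSpace k hk ⊗[ℂ] E) :
    inner ℂ (tensorToSeq x) (tensorToSeq y) = inner ℂ x y := by
  induction x with
  | zero => simp
  | add x x' hx hx' => simp [inner_add_left, hx, hx']
  | tmul f e =>
    induction y with
    | zero => simp
    | add y y' hy hy' => simp [inner_add_right, hy, hy']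
    | tmul g e' =>
      have hcoeff (n : ℕ) : inner ℂ (tensorToSeq (f ⊗ₜ[ℂ] e) n) (tensorToSeq (g ⊗ₜ[ℂ] e') n) =
          inner ℂ (toEll2 f n) (toEll2 g n) * inner ℂ e e' := by
        simp only [tensorToSeq_tmul, inner_smul_left, inner_smul_right, RCLike.inner_apply]
        ring
      rw [TensorProduct.inner_tmul]
      refine (lp.hasSum_inner _ _).unique ?_
      simp only [hcoeff]
      exact (lp.hasSum_inner (toEll2 f) (toEll2 g)).mul_right (inner ℂ e e')

theorem norm_tensorToSeq (x : WeightedSpace k hk ⊗[ℂ] E) : ‖tensorToSeq x‖ = ‖x‖ := by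
  rw [← sq_eq_sq₀ (norm_nonneg _) (norm_nonneg _), ← inner_self_eq_norm_sq (𝕜 := ℂ),
    ← inner_self_eq_norm_sq (𝕜 := ℂ), inner_tensorToSeq]

theorem tensorToSeq_single_tmul (n : ℕ) (e : E) :
    tensorToSeq ((toEll2.symm (lp.single 2 n (1 : ℂ)) : WeightedSpace k hk) ⊗ₜ[ℂ] e) =
      lp.single 2 n e := by
  ext m
  rw [tensorToSeq_tmul, LinearEquiv.apply_symm_apply]
  rcases eq_or_ne m n with rfl | hmn
  · simp
  · simp [hmn]

theorem denseRange_tensorToSeq :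
    DenseRange (tensorToSeq : WeightedSpace k hk ⊗[ℂ] E →ₗ[ℂ] lp (fun _ : ℕ => E) 2) := by
  intro v
  refine mem_closure_of_tendsto (lp.hasSum_single ENNReal.ofNat_ne_top v)
    (Eventually.of_forall fun s => ?_)
  exact ⟨∑ n ∈ s, toEll2.symm (lp.single 2 n (1 : ℂ)) ⊗ₜ[ℂ] v n, by
    simp only [map_sum, tensorToSeq_single_tmul]⟩

variable [CompleteSpace E]

variable (k hk E) in
/-- The Hilbert space `𝓗_k ⊗ E` is `ℓ²(E)` through `f ⊗ e ↦ (√k_n f_n e)_n`. -/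
noncomputable def tensorEquivSeq :
    HilbertTensor (WeightedSpace k hk) E ≃ₗᵢ[ℂ] lp (fun _ : ℕ => E) 2 :=
  (LinearEquiv.refl ℂ (WeightedSpace k hk ⊗[ℂ] E)).extendOfIsometry
    (UniformSpace.Completion.toComplₗᵢ (𝕜 := ℂ)).toLinearMap tensorToSeq
    UniformSpace.Completion.denseRange_coe denseRange_tensorToSeq
    fun x => (norm_tensorToSeq x).trans (UniformSpace.Completion.norm_coe x).symm

theorem tensorEquivSeq_coe (x : WeightedSpace k hk ⊗[ℂ] E) :
    tensorEquivSeq k hk E (x : HilbertTensor (WeightedSpace k hk) E) = tensorToSeq x :=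
  LinearEquiv.extendOfIsometry_eq ..

/-- The `n`-th Taylor coefficient of an element of `𝓗_k ⊗ E`, seen as an `E`-valued power
series. -/
noncomputable def tensorCoeff (n : ℕ) : HilbertTensor (WeightedSpace k hk) E →L[ℂ] E :=
  ((√(k n) : ℝ) : ℂ)⁻¹ • ((lp.evalCLM ℂ (fun _ : ℕ => E) 2 n).comp
    (tensorEquivSeq k hk E).toContinuousLinearEquiv.toContinuousLinearMap)

theorem tensorCoeff_apply (n : ℕ) (y : HilbertTensor (WeightedSpace k hk) E) :
    tensorCoeff n y = ((√(k n) : ℝ) : ℂ)⁻¹ • tensorEquivSeq k hk E y n := rfl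

theorem ofReal_sqrt_ne_zero (hk : ∀ n, 0 < k n) (n : ℕ) : ((√(k n) : ℝ) : ℂ) ≠ 0 :=
  Complex.ofReal_ne_zero.2 (Real.sqrt_pos.2 (hk n)).ne'

theorem tensorCoeff_tmul (n : ℕ) (f : WeightedSpace k hk) (e : E) :
    tensorCoeff n ((f ⊗ₜ[ℂ] e : WeightedSpace k hk ⊗[ℂ] E) :
      HilbertTensor (WeightedSpace k hk) E) = coeff n f • e := by
  have hcoeff : toEll2 f n = ((√(k n) : ℝ) : ℂ) * coeff n f := rfl
  rw [tensorCoeff_apply, tensorEquivSeq_coe, tensorToSeq_tmul, hcoeff, smul_smul,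
    inv_mul_cancel_left₀ (ofReal_sqrt_ne_zero hk n)]

theorem hasSum_tensorCoeff (y : HilbertTensor (WeightedSpace k hk) E) :
    HasSum (fun n => k n * ‖tensorCoeff n y‖ ^ 2) (‖y‖ ^ 2) := by
  have h := lp.hasSum_norm (p := 2) (by norm_num) (tensorEquivSeq k hk E y)
  simp only [ENNReal.toReal_ofNat, Real.rpow_ofNat, LinearIsometryEquiv.norm_map] at h
  convert h using 2 with n
  rw [tensorCoeff_apply, norm_smul, mul_pow, norm_inv, Complex.norm_real, Real.norm_eq_abs,
    inv_pow, sq_abs, Real.sq_sqrt (hk n).le, mul_inv_cancel_left₀ (hk n).ne']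

theorem tensor_ext {y z : HilbertTensor (WeightedSpace k hk) E}
    (h : ∀ n, tensorCoeff n y = tensorCoeff n z) : y = z := by
  refine (tensorEquivSeq k hk E).injective (lp.ext (funext fun n => ?_))
  exact smul_right_injective E (inv_ne_zero (ofReal_sqrt_ne_zero hk n)) (h n)

theorem exists_forall_tensorCoeff_eq {u : ℕ → E} (hu : Summable fun n => k n * ‖u n‖ ^ 2) :
    ∃ y : HilbertTensor (WeightedSpace k hk) E, ∀ n, tensorCoeff n y = u n := by
  have hmem : Memℓp (fun n => ((√(k n) : ℝ) : ℂ) • u n) 2 := by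
    rw [memℓp_gen_iff (by norm_num)]
    refine hu.congr fun n => ?_
    rw [norm_smul, Complex.norm_real, Real.norm_eq_abs, ENNReal.toReal_ofNat,
      Real.rpow_ofNat, mul_pow, sq_abs, Real.sq_sqrt (hk n).le]
  refine ⟨(tensorEquivSeq k hk E).symm ⟨_, hmem⟩, fun n => ?_⟩
  rw [tensorCoeff_apply, LinearIsometryEquiv.apply_symm_apply]
  exact inv_smul_smul₀ (ofReal_sqrt_ne_zero hk n) (u n)

theorem exists_linearMap_tensorCoeff_eq {H : Type*} [AddCommGroup H] [Module ℂ H]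
    (c : ℕ → H →ₗ[ℂ] E) (hc : ∀ x, Summable fun n => k n * ‖c n x‖ ^ 2) :
    ∃ V : H →ₗ[ℂ] HilbertTensor (WeightedSpace k hk) E, ∀ n x, tensorCoeff n (V x) = c n x := by
  choose V hV using fun x => exists_forall_tensorCoeff_eq (hk := hk) (hc x)
  refine ⟨{ toFun := V, map_add' := fun x y => ?_, map_smul' := fun z x => ?_ }, fun n x => hV x n⟩
  · exact tensor_ext fun n => by simp only [map_add, hV]
  · exact tensor_ext fun n => by simp only [map_smul, hV, RingHom.id_apply]

theorem tensorCoeff_tensorId_backwardShift (hb : ∃ C : ℝ, ∀ n, k n ≤ C * k (n + 1)) (n : ℕ)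
    (y : HilbertTensor (WeightedSpace k hk) E) :
    tensorCoeff n (tensorId (backwardShift hb) E y) = tensorCoeff (n + 1) y := by
  induction y using UniformSpace.Completion.induction_on with
  | hp => exact isClosed_eq (by fun_prop) (by fun_prop)
  | ih x =>
    have hcoe (x : WeightedSpace k hk ⊗[ℂ] E) : tensorId (backwardShift hb) E
        (x : HilbertTensor (WeightedSpace k hk) E) =
        (((backwardShift hb).rTensor E x : WeightedSpace k hk ⊗[ℂ] E) :
          HilbertTensor (WeightedSpace k hk) E) := by
      simp [tensorId]
    rw [hcoe]
    induction x with
    | zero => simp only [map_zero, UniformSpace.Completion.coe_zero]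
    | add x y hx hy => simp only [map_add, UniformSpace.Completion.coe_add, hx, hy]
    | tmul f e =>
      have htmul : (backwardShift hb).rTensor E (f ⊗ₜ[ℂ] e) = (backwardShift hb f) ⊗ₜ[ℂ] e := rfl
      rw [htmul, tensorCoeff_tmul, tensorCoeff_tmul, coeff_backwardShift]

theorem tensorCoeff_tensorId_backwardShift_pow (hb : ∃ C : ℝ, ∀ n, k n ≤ C * k (n + 1)) (m n : ℕ)
    (y : HilbertTensor (WeightedSpace k hk) E) :
    tensorCoeff n ((tensorId (backwardShift hb) E ^ m) y) = tensorCoeff (n + m) y := by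
  induction m generalizing n with
  | zero => simp
  | succ m ih =>
    rw [pow_succ', mul_apply_eq_comp, tensorCoeff_tensorId_backwardShift, ih,
      add_right_comm, add_assoc]

end WeightedSpace

/-! ### Parts of `(B_a ⊗ I_E) ⊕ S` are `a`-contractions -/

section ModelToContraction

theorem sum_range_mul_ite_nonneg {α k : ℕ → ℝ} (hα : ∀ n, α (n + 1) ≤ 0) (hk : ∀ n, 0 ≤ k n)
    (hαk : PowerSeries.mk α * PowerSeries.mk k = 1) (N j : ℕ) :
    0 ≤ ∑ n ∈ Finset.range N, α n * (if n ≤ j then k (j - n) else 0) := by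
  obtain _ | N := N
  · exact Finset.sum_nonneg (by simp)
  set g : ℕ → ℝ := fun n => α n * (if n ≤ j then k (j - n) else 0)
  have hg_nonpos (n : ℕ) : g (n + 1) ≤ 0 :=
    mul_nonpos_of_nonpos_of_nonneg (hα n) (by split_ifs <;> simp only [hk, le_refl])
  have hg_zero (n : ℕ) (hn : j < n) : g n = 0 := by simp only [g, hn.not_ge, if_false, mul_zero]
  have hanti : Antitone fun N => ∑ n ∈ Finset.range (N + 1), g n :=
    antitone_nat_of_succ_le fun N => by
      rw [Finset.sum_range_succ _ (N + 1)]
      exact add_le_of_nonpos_right (hg_nonpos N)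
  have hfull : 0 ≤ ∑ n ∈ Finset.range (j + 1), g n := by
    have hconv : ∑ n ∈ Finset.range (j + 1), g n = remainderWeight α k 0 j := by
      simp only [remainderWeight, zero_add, Finset.Nat.sum_antidiagonal_eq_sum_range_succ
        (fun p q => α p * k q)]
      exact Finset.sum_congr rfl fun n hn => by
        simp only [g, Nat.lt_succ_iff.1 (Finset.mem_range.1 hn), if_true]
    rw [hconv, remainderWeight_zero_left hαk]
    split_ifs <;> norm_num
  rcases le_total N j with hN | hN
  · exact hfull.trans (hanti hN)
  · refine hfull.trans_eq (Finset.sum_subset (Finset.range_mono (by lia)) fun n _ hn => ?_)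
    exact hg_zero n (by simpa using hn)

theorem WeightedSpace.hasSum_norm_tensorId_backwardShift_pow {k : ℕ → ℝ} {hk : ∀ n, 0 < k n}
    {E : Type*} [NormedAddCommGroup E] [InnerProductSpace ℂ E] [CompleteSpace E]
    (hb : ∃ C : ℝ, ∀ n, k n ≤ C * k (n + 1)) (y : HilbertTensor (WeightedSpace k hk) E) (n : ℕ) :
    HasSum (fun j => (if n ≤ j then k (j - n) else 0) * ‖tensorCoeff j y‖ ^ 2)
      (‖(tensorId (WeightedSpace.backwardShift hb) E ^ n) y‖ ^ 2) := by
  have hshift := hasSum_tensorCoeff ((tensorId (WeightedSpace.backwardShift hb) E ^ n) y)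
  simp only [tensorCoeff_tensorId_backwardShift_pow] at hshift
  rw [← hasSum_nat_add_iff' n, Finset.sum_eq_zero, sub_zero]
  · simpa only [Nat.le_add_left, if_true, Nat.add_sub_cancel] using hshift
  · intro i hi
    rw [if_neg (not_le.2 (Finset.mem_range.1 hi)), zero_mul]

theorem WeightedSpace.sum_range_mul_norm_tensorId_backwardShift_pow_nonneg {α k : ℕ → ℝ}
    {hk : ∀ n, 0 < k n} {E : Type*} [NormedAddCommGroup E] [InnerProductSpace ℂ E]
    [CompleteSpace E] (hα : ∀ n, α (n + 1) ≤ 0) (hαk : PowerSeries.mk α * PowerSeries.mk k = 1)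
    (hb : ∃ C : ℝ, ∀ n, k n ≤ C * k (n + 1)) (y : HilbertTensor (WeightedSpace k hk) E) (N : ℕ) :
    0 ≤ ∑ n ∈ Finset.range N,
      α n * ‖(tensorId (WeightedSpace.backwardShift hb) E ^ n) y‖ ^ 2 := by
  refine (hasSum_sum fun n _ =>
    (hasSum_norm_tensorId_backwardShift_pow hb y n).mul_left (α n)).nonneg fun j => ?_
  simp only [← mul_assoc, ← Finset.sum_mul]
  exact mul_nonneg (sum_range_mul_ite_nonneg hα (fun n => (hk n).le) hαk N j) (sq_nonneg _)

theorem norm_directSum_pow_apply_sq {X Y : Type*} [NormedAddCommGroup X] [InnerProductSpace ℂ X]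
    [NormedAddCommGroup Y] [InnerProductSpace ℂ Y] (A : X →L[ℂ] X) (S : Y →ₗᵢ[ℂ] Y) (n : ℕ)
    (w : WithLp 2 (X × Y)) :
    ‖(directSum A S.toContinuousLinearMap ^ n) w‖ ^ 2 = ‖(A ^ n) w.fst‖ ^ 2 + ‖w.snd‖ ^ 2 := by
  induction n generalizing w with
  | zero => exact WithLp.prod_norm_sq_eq_of_L2 w
  | succ n ih =>
    rw [pow_succ (directSum _ _), mul_apply_eq_comp, ih, pow_succ A, mul_apply_eq_comp]
    exact congrArg (fun r => ‖(A ^ n) (A w.fst)‖ ^ 2 + r ^ 2) (S.norm_map w.snd)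

theorem IsUnitarilyEquivalentToPart.exists_norm_pow_eq {H X : Type*} [NormedAddCommGroup H]
    [InnerProductSpace ℂ H] [NormedAddCommGroup X] [InnerProductSpace ℂ X] {T : H →L[ℂ] H}
    {A : X →L[ℂ] X} (h : IsUnitarilyEquivalentToPart T A) (x : H) :
    ∃ w : X, ∀ n, ‖(T ^ n) x‖ = ‖(A ^ n) w‖ := by
  obtain ⟨M, hM, U, -, hU⟩ := h
  have hpow (n : ℕ) : (U ((T ^ n) x) : X) = (A ^ n) (U x) := by
    induction n with
    | zero => rfl
    | succ n ih =>
      rw [pow_succ', mul_apply_eq_comp, hU, pow_succ', mul_apply_eq_comp, ← ih]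
      rfl
  exact ⟨U x, fun n => by rw [← hpow, Submodule.norm_coe, U.norm_map]⟩

theorem HasModel.isAContraction {H : Type u} [NormedAddCommGroup H] [InnerProductSpace ℂ H]
    [CompleteSpace H] {a : ℝ} {ha₀ : 0 < a} (ha₁ : a ≤ 1) {T : H →L[ℂ] H} {E : Type u}
    [NormedAddCommGroup E] [InnerProductSpace ℂ E] [CompleteSpace E] (h : HasModel a ha₀ T E) :
    IsAContraction a T := by
  obtain ⟨K, _, _, _, S, hT⟩ := h
  have hα := cesaroNumber_neg_succ_nonpos ha₀.le ha₁
  refine exists_isPositive_hasHereditarySum hα fun N x => ?_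
  obtain ⟨w, hw⟩ := hT.exists_norm_pow_eq x
  simp only [hw, norm_directSum_pow_apply_sq, mul_add, Finset.sum_add_distrib, ← Finset.sum_mul]
  exact add_nonneg
    (WeightedSpace.sum_range_mul_norm_tensorId_backwardShift_pow_nonneg hα
      (mk_cesaroNumber_neg_mul_mk_cesaroNumber a) _ _ N)
    (mul_nonneg (sum_range_cesaroNumber_neg_nonneg ha₁ N) (sq_nonneg _))

end ModelToContraction

/-! ### The model of an `a`-contraction -/

section ContractionToModel

variable {H : Type u} [NormedAddCommGroup H] [InnerProductSpace ℂ H]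

theorem exists_isometry_topologicalClosure_range {K : Type*} [NormedAddCommGroup K]
    [InnerProductSpace ℂ K] [CompleteSpace K] {L : H →ₗ[ℂ] K} {T : H →ₗ[ℂ] H}
    (h : ∀ x, ‖L (T x)‖ = ‖L x‖) :
    ∃ S : L.range.topologicalClosure →ₗᵢ[ℂ] L.range.topologicalClosure,
      ∀ x, (S ⟨L x, subset_closure ⟨x, rfl⟩⟩ : K) = L (T x) := by
  let e : H →ₗ[ℂ] L.range.topologicalClosure :=
    L.codRestrict _ fun x => subset_closure ⟨x, rfl⟩
  have hdense : DenseRange e := fun y => by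
    have himage : Subtype.val '' Set.range e = (L.range : Set K) := (Set.range_comp _ e).symm
    rw [closure_subtype, himage]
    exact y.2
  have hF : ∀ x, (e ∘ₗ T).extendOfNorm e (e x) = e (T x) :=
    LinearMap.extendOfNorm_eq hdense ⟨1, fun x => by rw [one_mul]; exact (h x).le⟩
  refine ⟨⟨((e ∘ₗ T).extendOfNorm e).toLinearMap, fun y => ?_⟩,
    fun x => congrArg Subtype.val (hF x)⟩
  refine hdense.induction_on y (isClosed_eq (by fun_prop) (by fun_prop)) fun x => ?_
  exact (congrArg norm (hF x)).trans (h x)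

theorem isUnitarilyEquivalentToPart_directSum [CompleteSpace H] {X K : Type*}
    [NormedAddCommGroup X] [InnerProductSpace ℂ X] [NormedAddCommGroup K] [InnerProductSpace ℂ K]
    {T : H →L[ℂ] H} {A : X →L[ℂ] X} {S : K →L[ℂ] K} (V : H →ₗ[ℂ] X) (L : H →ₗ[ℂ] K)
    (hnorm : ∀ x, ‖V x‖ ^ 2 + ‖L x‖ ^ 2 = ‖x‖ ^ 2) (hV : ∀ x, V (T x) = A (V x))
    (hL : ∀ x, L (T x) = S (L x)) : IsUnitarilyEquivalentToPart T (directSum A S) := by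
  let J : H →ₗᵢ[ℂ] WithLp 2 (X × K) :=
    { toLinearMap := (WithLp.linearEquiv 2 ℂ (X × K)).symm.toLinearMap ∘ₗ V.prod L
      norm_map' := fun x => by
        rw [← sq_eq_sq₀ (norm_nonneg _) (norm_nonneg _), ← hnorm x]
        exact WithLp.prod_norm_sq_eq_of_L2 _ }
  have hJ (x : H) : J (T x) = directSum A S (J x) := by
    change WithLp.toLp 2 (V (T x), L (T x)) = WithLp.toLp 2 (A (V x), S (L x))
    rw [hV, hL]
  refine ⟨LinearMap.range J.toLinearMap, ?_, J.equivRange,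
    J.isometry.isClosedEmbedding.isClosed_range, fun x => Subtype.ext (hJ x)⟩
  rintro _ ⟨x, rfl⟩
  exact ⟨T x, hJ x⟩

theorem exists_norm_sq_add_norm_sq_eq [CompleteSpace H] {X : Type*} [NormedAddCommGroup X]
    [InnerProductSpace ℂ X] [CompleteSpace X] {V : H →L[ℂ] X} (hV : ∀ x, ‖V x‖ ≤ ‖x‖) :
    ∃ L : H →L[ℂ] H, ∀ x, ‖V x‖ ^ 2 + ‖L x‖ ^ 2 = ‖x‖ ^ 2 := by
  set Q : H →L[ℂ] H := 1 - ContinuousLinearMap.adjoint V ∘L V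
  have hQ (x : H) : inner ℂ (Q x) x = ((‖x‖ ^ 2 - ‖V x‖ ^ 2 : ℝ) : ℂ) := by
    change inner ℂ (x - ContinuousLinearMap.adjoint V (V x)) x = _
    rw [inner_sub_left, ContinuousLinearMap.adjoint_inner_left, inner_self_eq_norm_sq_to_K,
      inner_self_eq_norm_sq_to_K]
    simp
  have hQ_pos : Q.IsPositive := (isPositive_iff_forall_inner_nonneg Q).2 fun x => by
    rw [hQ, Complex.zero_le_real, sub_nonneg]
    exact pow_le_pow_left₀ (norm_nonneg _) (hV x) 2
  refine ⟨CFC.sqrt Q, fun x => ?_⟩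
  rw [norm_sqrt_apply_sq hQ_pos, hQ, Complex.ofReal_re, add_sub_cancel]

theorem exists_isUnitarilyEquivalentToPart_directSum [CompleteSpace H] {X : Type*}
    [NormedAddCommGroup X] [InnerProductSpace ℂ X] [CompleteSpace X] {T : H →L[ℂ] H}
    {A : X →L[ℂ] X} (V : H →ₗ[ℂ] X) (hV : ∀ x, ‖V x‖ ≤ ‖x‖)
    (hVT : ∀ x, ‖T x‖ ^ 2 - ‖V (T x)‖ ^ 2 = ‖x‖ ^ 2 - ‖V x‖ ^ 2)
    (hVA : ∀ x, V (T x) = A (V x)) :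
    ∃ (K : Type u) (_ : NormedAddCommGroup K) (_ : InnerProductSpace ℂ K) (_ : CompleteSpace K)
      (S : K →ₗᵢ[ℂ] K), IsUnitarilyEquivalentToPart T (directSum A S.toContinuousLinearMap) := by
  obtain ⟨L, hL⟩ := exists_norm_sq_add_norm_sq_eq
    (V := V.mkContinuous 1 fun x => (hV x).trans_eq (one_mul _).symm) hV
  have hLT (x : H) : ‖L (T x)‖ = ‖L x‖ := by
    rw [← sq_eq_sq₀ (norm_nonneg _) (norm_nonneg _), ← sub_eq_of_eq_add' (hL x).symm,
      ← sub_eq_of_eq_add' (hL (T x)).symm]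
    exact hVT x
  obtain ⟨S, hS⟩ := exists_isometry_topologicalClosure_range
    (L := L.toLinearMap) (T := T.toLinearMap) hLT
  exact ⟨L.range.topologicalClosure, inferInstance, inferInstance, inferInstance, S,
    isUnitarilyEquivalentToPart_directSum V
      (L.toLinearMap.codRestrict _ fun x => subset_closure ⟨x, rfl⟩) hL hVA
      fun x => Subtype.ext (hS x).symm⟩

variable [CompleteSpace H] {a : ℝ} {T : H →L[ℂ] H}

theorem IsAContraction.hasSum_norm_pow (h : IsAContraction a T) (ha₀ : 0 ≤ a) (ha₁ : a ≤ 1)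
    (x : H) (m : ℕ) :
    HasSum (fun n => cesaroNumber (-a) n * ‖(T ^ (n + m)) x‖ ^ 2)
      (‖defectOperator a T ((T ^ m) x)‖ ^ 2) := by
  obtain ⟨A, hA, hA_pos⟩ := h
  rw [defectOperator, hA.hereditary_eq, norm_sqrt_apply_sq hA_pos]
  simpa only [pow_add, mul_apply_eq_comp] using
    hA.hasSum (cesaroNumber_neg_succ_nonpos ha₀ ha₁) ((T ^ m) x)

theorem IsAContraction.exists_tensorCoeff_eq_defectOperator_pow (h : IsAContraction a T)
    (ha₀ : 0 < a) (ha₁ : a ≤ 1) :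
    ∃ V : H →ₗ[ℂ] HilbertTensor (PowerSeriesSpace a ha₀) (defectSpace a T),
      ∀ n x, ((WeightedSpace.tensorCoeff n (V x) : defectSpace a T) : H) =
        defectOperator a T ((T ^ n) x) := by
  let c (n : ℕ) : H →ₗ[ℂ] defectSpace a T :=
    (defectOperator a T * T ^ n).toLinearMap.codRestrict _ fun x => subset_closure ⟨_, rfl⟩
  obtain ⟨V, hV⟩ := WeightedSpace.exists_linearMap_tensorCoeff_eq
    (hk := cesaroNumber_pos ha₀) c fun x =>
      summable_cesaroNumber_mul ha₀.le ha₁ (u := fun n => ‖(T ^ n) x‖ ^ 2)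
        (fun n => sq_nonneg _) (h.hasSum_norm_pow ha₀.le ha₁ x) fun m => sq_nonneg _
  exact ⟨V, fun n x => congrArg Subtype.val (hV n x)⟩

theorem IsAContraction.hasModel (h : IsAContraction a T) (ha₀ : 0 < a) (ha₁ : a ≤ 1) :
    HasModel a ha₀ T (defectSpace a T) := by
  obtain ⟨V, hV⟩ := h.exists_tensorCoeff_eq_defectOperator_pow ha₀ ha₁
  have hV_norm (x : H) : ‖V x‖ ^ 2 =
      ∑' m, cesaroNumber a m * ‖defectOperator a T ((T ^ m) x)‖ ^ 2 := by
    simp only [← (WeightedSpace.hasSum_tensorCoeff (V x)).tsum_eq, ← hV, Submodule.coe_norm]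
  have hsum (x : H) := h.hasSum_norm_pow ha₀.le ha₁ x
  have hle (x : H) : ‖V x‖ ^ 2 ≤ ‖x‖ ^ 2 := by
    rw [hV_norm]
    exact tsum_cesaroNumber_mul_le ha₀.le ha₁ (u := fun n => ‖(T ^ n) x‖ ^ 2)
      (fun n => sq_nonneg _) (hsum x) fun m => sq_nonneg _
  have hdiff (x : H) : ‖T x‖ ^ 2 - ‖V (T x)‖ ^ 2 = ‖x‖ ^ 2 - ‖V x‖ ^ 2 := by
    rw [hV_norm, hV_norm]
    exact sub_tsum_cesaroNumber_mul_shift ha₀.le ha₁ (u := fun n => ‖(T ^ n) x‖ ^ 2)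
      (fun n => sq_nonneg _) (hsum x) fun m => sq_nonneg _
  refine exists_isUnitarilyEquivalentToPart_directSum V
    (fun x => le_of_sq_le_sq (hle x) (norm_nonneg x)) hdiff fun x => ?_
  refine WeightedSpace.tensor_ext fun n => Subtype.ext ?_
  rw [backwardShift, WeightedSpace.tensorCoeff_tensorId_backwardShift, hV, hV, pow_succ,
    mul_apply_eq_comp]

end ContractionToModel

theorem theorem1p3_general {H : Type u} [NormedAddCommGroup H] [InnerProductSpace ℂ H]
    [CompleteSpace H] (a : ℝ) (ha₀ : 0 < a) (ha₁ : a ≤ 1) (T : H →L[ℂ] H) :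
    List.TFAE [IsAContraction a T,
      ∃ (E : Type u) (_ : NormedAddCommGroup E) (_ : InnerProductSpace ℂ E) (_ : CompleteSpace E),
        HasModel a ha₀ T E,
      HasModel a ha₀ T (defectSpace a T)] := by
  tfae_have 1 → 3 := fun h => h.hasModel ha₀ ha₁
  tfae_have 3 → 2 := fun h => ⟨defectSpace a T, inferInstance, inferInstance, inferInstance, h⟩
  tfae_have 2 → 1 := fun ⟨_, _, _, _, h⟩ => h.isAContraction ha₁
  tfae_finish

theorem theorem1p3 {H : Type u} [NormedAddCommGroup H] [InnerProductSpace ℂ H]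
    [CompleteSpace H] [TopologicalSpace.SeparableSpace H]
    (a : ℝ) (ha₀ : 0 < a) (ha₁ : a < 1) (T : H →L[ℂ] H) :
    (IsAContraction a T ↔
      ∃ (E : Type u) (_ : NormedAddCommGroup E) (_ : InnerProductSpace ℂ E) (_ : CompleteSpace E)
        (_ : TopologicalSpace.SeparableSpace E), HasModel a ha₀ T E) ∧
    ((∃ (E : Type u) (_ : NormedAddCommGroup E) (_ : InnerProductSpace ℂ E) (_ : CompleteSpace E)
        (_ : TopologicalSpace.SeparableSpace E), HasModel a ha₀ T E) →
      HasModel a ha₀ T (defectSpace a T)) := by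
  have htfae := theorem1p3_general a ha₀ ha₁.le T
  have isAContraction_of_model := (htfae.out 1 0).1
  have hasModel_defectSpace := (htfae.out 0 2).1
  refine ⟨⟨fun h => ⟨defectSpace a T, inferInstance, inferInstance, inferInstance,
    (TopologicalSpace.IsSeparable.of_separableSpace _).separableSpace, hasModel_defectSpace h⟩,
    fun ⟨E, _, _, _, _, h⟩ => ?_⟩, fun ⟨E, _, _, _, _, h⟩ => ?_⟩
  · exact isAContraction_of_model ⟨E, _, _, ‹_›, h⟩
  · exact hasModel_defectSpace (isAContraction_of_model ⟨E, _, _, ‹_›, h⟩)
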